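/- **Theorem 4.** Let $K,L,N\ge 1$ and $M>K$ be integers, let $P,\tau_0,\sigma,H>0$, let $(a_{k,l}[n],b_{k,l}[n])\in\mathbb{R}^2$ be user locations, and let $D_m[n]\ge 0$ ($1\le n\le N-1$). The indices run over $1\le k\le K$, $1\le l\le L$, $1\le m\le M$, $1\le n\le N$ (and $1\le n\le N-1$ in the last constraint). Consider the problem, in the real variables $x_m[n],y_m[n]$, $c_{k,l,m}[n]>0$ and $R$, $$\text{(P2-eqv)}\quad \max\ R\quad\text{s.t.}\quad \frac{1}{NL}\sum_{n=1}^N\log_2\Big(1+\frac{P\tau_0\sum_{m=1}^M c_{k,l,m}[n]}{M\sigma^2/(M-K)}\Big)\ge R\quad\forall k,l,$$ $$(x_m[n]-a_{k,l}[n])^2+(y_m[n]-b_{k,l}[n])^2+H^2\le \frac{1}{c_{k,l,m}[n]}\quad\forall k,l,m,n,$$ $$(x_m[n+1]-x_m[n])^2+(y_m[n+1]-y_m[n])^2\le D_m[n]^2\quad\forall m,\ n=1,\dots,N-1.$$ For $\tilde c=(\tilde c_{k,l,m}[n])$ with all entries positive, let $\mathrm{A}(\tilde c)$ be the convex problem obtained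 from (P2-eqv) by replacing each $1/c_{k,l,m}[n]$ by its first-order approximation $\frac{1}{\tilde c_{k,l,m}[n]}-\frac{1}{\tilde c_{k,l,m}[n]^2}(c_{k,l,m}[n]-\tilde c_{k,l,m}[n])$. A *run* of the successive-convex-approximation procedure (Algorithm 1) started at $c^{(0)}>0$ is a finite or infinite sequence $z^{(q)}=(x^{(q)},y^{(q)},c^{(q)},R^{(q)})$, $q=1,2,\dots$, in which $z^{(q)}$ is an optimal solution of $\mathrm{A}(c^{(q-1)})$ for every $q$; the algorithm stops as soon as $R^{(q)}-R^{(q-1)}\le\epsilon$ for some $q\ge2$, where $\epsilon>0$ is given. 1. In every run, $R^{(q)}\ge R^{(q-1)}$ for all $q\ge 2$ (up to the length of the run). In every infinite run, $R^{(q)}$ converges to a real number; consequently the stopping criterion is met after finitely many iterations, for every $\epsilon>0$. 2. Let $z^*$ be a converged solution, that is, either $z^*=z^{(q)}$ for some $q\ge 2$ with $R^{(q)}=R^{(q-1)}$, or $z^*$ is a cluster point (in particular, the limit, if it exists) of the iterates of an infinite run such that all $c^*_{k,l,m}[n]>0$. If $D_m[n]>0$ for all $m,n$, then $z^*$ satisfies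 all the Karush–Kuhn–Tucker conditions of (P2-eqv): primal feasibility, and there are nonnegative multipliers satisfying complementary slackness and stationarity of the Lagrangian. If some $D_m[n]$ vanish, the same holds once the equations $x_m[n+1]=x_m[n]$ and $y_m[n+1]=y_m[n]$, with multipliers of arbitrary sign, are adjoined for each pair $(m,n)$ with $D_m[n]=0$ (there they are equivalent to the displacement constraint). -/

import Mathlib

/-- `z` satisfies the Karush-Kuhn-Tucker conditions of the problem
`maximize f` subject to `g i ≤ 0` for all `i` and `h j = 0` for all `j`:
primal feasibility, dual feasibility, complementary slackness and stationarity of the Lagrangian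
(all functions involved being differentiable at `z`). -/
def IsKKTPoint {E ι κ : Type*} [NormedAddCommGroup E] [NormedSpace ℝ E] [Fintype ι] [Fintype κ]
    (f : E → ℝ) (g : ι → E → ℝ) (h : κ → E → ℝ) (z : E) : Prop :=
  DifferentiableAt ℝ f z ∧ (∀ i, DifferentiableAt ℝ (g i) z) ∧ (∀ j, DifferentiableAt ℝ (h j) z) ∧
  (∀ i, g i z ≤ 0) ∧ (∀ j, h j z = 0) ∧
  ∃ (u : ι → ℝ) (v : κ → ℝ), (∀ i, 0 ≤ u i) ∧ (∀ i, u i * g i z = 0) ∧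
    fderiv ℝ f z = ∑ i, u i • fderiv ℝ (g i) z + ∑ j, v j • fderiv ℝ (h j) z

/-- The data: `K` users in each of `L` groups, `M` UAVs, `N` episodes, transmit power `P`, reference
channel gain `τ₀`, noise variance `σ ^ 2`, altitude `H`, nominal user locations
`(a k l n, b k l n)`, and the maximum displacement `D m n` of UAV `m` between the episodes `n` and
`n + 1`, for the `N - 1` pairs of consecutive episodes. -/
structure UAVSystem (K L M N : ℕ) where
  P : ℝ
  τ₀ : ℝ
  σ : ℝ
  H : ℝ
  a : Fin K → Fin L → Fin N → ℝ
  b : Fin K → Fin L → Fin N → ℝ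
  D : Fin M → Fin (N - 1) → ℝ

/-- The auxiliary variables `c k l m n`. -/
abbrev AuxVar (K L M N : ℕ) : Type := Fin K → Fin L → Fin M → Fin N → ℝ

/-- The variables `(x, y, c, R)` of the optimization problems. -/
abbrev UAVPoint (K L M N : ℕ) : Type :=
  (Fin M → Fin N → ℝ) × (Fin M → Fin N → ℝ) × AuxVar K L M N × ℝ

namespace UAVPoint

variable {K L M N : ℕ}

/-- The UAV locations, first coordinate. -/
def x (z : UAVPoint K L M N) : Fin M → Fin N → ℝ := z.1

/-- The UAV locations, second coordinate. -/
def y (z : UAVPoint K L M N) : Fin M → Fin N → ℝ := z.2.1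

/-- The auxiliary variables. -/
def c (z : UAVPoint K L M N) : AuxVar K L M N := z.2.2.1

/-- The minimum rate variable, which is the objective of all the problems below. -/
def R (z : UAVPoint K L M N) : ℝ := z.2.2.2

end UAVPoint

/-- The first of the two consecutive episodes indexed by `n`. -/
def thisEpisode {N : ℕ} (n : Fin (N - 1)) : Fin N := ⟨n.1, by omega⟩

/-- The second of the two consecutive episodes indexed by `n`. -/
def nextEpisode {N : ℕ} (n : Fin (N - 1)) : Fin N := ⟨n.1 + 1, by omega⟩

namespace UAVPoint

variable {K L M N : ℕ}

/-- The squared displacement of UAV `m` between two consecutive episodes. -/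
def moveSq (z : UAVPoint K L M N) (m : Fin M) (n : Fin (N - 1)) : ℝ :=
  (z.x m (nextEpisode n) - z.x m (thisEpisode n)) ^ 2 +
    (z.y m (nextEpisode n) - z.y m (thisEpisode n)) ^ 2

end UAVPoint

/-- Index of the inequality constraints: the rate constraints, the constraints on the auxiliary
variables, and the constraints on the UAV displacements. -/
abbrev ConstraintIndex (K L M N : ℕ) : Type :=
  (Fin K × Fin L) ⊕ (Fin K × Fin L × Fin M × Fin N) ⊕ (Fin M × Fin (N - 1))

/-- The first-order approximation of `1 / c` at the point `ct`. -/
noncomputable def invApprox (c ct : ℝ) : ℝ := 1 / ct - 1 / ct ^ 2 * (c - ct)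

namespace UAVSystem

variable {K L M N : ℕ} (S : UAVSystem K L M N)

/-- The average rate of user `k` of group `l` as a function of the auxiliary variables. -/
noncomputable def rate (k : Fin K) (l : Fin L) (c : AuxVar K L M N) : ℝ :=
  1 / ((N : ℝ) * L) * ∑ n, Real.logb 2
    (1 + S.P * S.τ₀ * (∑ m, c k l m n) / (M * S.σ ^ 2 / ((M : ℝ) - K)))

/-- The squared distance between UAV `m` and user `k` of group `l` in episode `n`. -/
def distSq (k : Fin K) (l : Fin L) (m : Fin M) (n : Fin N) (z : UAVPoint K L M N) : ℝ :=
  (z.x m n - S.a k l n) ^ 2 + (z.y m n - S.b k l n) ^ 2 + S.H ^ 2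

/-- The inequality constraints, written as `· ≤ 0`, of the original problem:
maximize `R` over `(x, y, c, R)` with `c > 0`, subject to
`R ≤ rate k l c`, `distSq k l m n ≤ 1 / c k l m n` and `moveSq m n ≤ D m n ^ 2`. -/
noncomputable def constraint : ConstraintIndex K L M N → UAVPoint K L M N → ℝ
  | .inl (k, l), z => z.R - S.rate k l z.c
  | .inr (.inl (k, l, m, n)), z => S.distSq k l m n z - 1 / z.c k l m n
  | .inr (.inr (m, n)), z => z.moveSq m n - S.D m n ^ 2

/-- The same constraints with `1 / c` replaced by its first-order approximation at `ct`. -/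
noncomputable def approxConstraint (ct : AuxVar K L M N) :
    ConstraintIndex K L M N → UAVPoint K L M N → ℝ
  | .inl (k, l), z => z.R - S.rate k l z.c
  | .inr (.inl (k, l, m, n)), z => S.distSq k l m n z - invApprox (z.c k l m n) (ct k l m n)
  | .inr (.inr (m, n)), z => z.moveSq m n - S.D m n ^ 2

/-- The feasible set of the approximate problem at `ct`. -/
def approxFeasible (ct : AuxVar K L M N) : Set (UAVPoint K L M N) :=
  {z | (∀ k l m n, 0 < z.c k l m n) ∧ ∀ i, S.approxConstraint ct i z ≤ 0}

/-- `z` is an optimal solution of the approximate problem at `ct`. -/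
def IsApproxSolution (ct : AuxVar K L M N) (z : UAVPoint K L M N) : Prop :=
  z ∈ S.approxFeasible ct ∧ ∀ w ∈ S.approxFeasible ct, w.R ≤ z.R

/-- The point at which iteration `q ≥ 1` linearizes: the initial value `c₀` in iteration `1`, the
`c`-part of the previous iterate afterwards. -/
def linPoint (c₀ : AuxVar K L M N) (z : ℕ → UAVPoint K L M N) (q : ℕ) : AuxVar K L M N :=
  if q ≤ 1 then c₀ else (z (q - 1)).c

/-- `z 1, …, z Q` are iterates of the successive convex approximation procedure started at
`c₀ > 0` (the value `z 0` is not used). -/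
def IsRun (c₀ : AuxVar K L M N) (z : ℕ → UAVPoint K L M N) (Q : ℕ) : Prop :=
  (∀ k l m n, 0 < c₀ k l m n) ∧
    ∀ q, 1 ≤ q → q ≤ Q → S.IsApproxSolution (linPoint c₀ z q) (z q)

/-- `w` is a converged solution of the procedure: either the objective value has stopped
changing in some iteration `q` and `w` is the iterate `z q`, or `w` is a cluster point (for
instance the limit) of an infinite run and `w` lies in the domain `c > 0` of the problem. -/
def IsConvergedSolution (c₀ : AuxVar K L M N) (z : ℕ → UAVPoint K L M N)
    (w : UAVPoint K L M N) : Prop :=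
  (∃ q, 2 ≤ q ∧ S.IsRun c₀ z q ∧ (z q).R = (z (q - 1)).R ∧ w = z q) ∨
  ((∀ Q, S.IsRun c₀ z Q) ∧ MapClusterPt w Filter.atTop z ∧ ∀ k l m n, 0 < w.c k l m n)

/-- The KKT conditions of the original problem. -/
def IsKKT (z : UAVPoint K L M N) : Prop :=
  IsKKTPoint UAVPoint.R S.constraint (fun j : Empty => j.elim) z

/-- The pairs of a UAV and two consecutive episodes between which the UAV must not move. -/
abbrev StaticIndex : Type := {p : Fin M × Fin (N - 1) // S.D p.1 p.2 = 0}

/-- For the pairs with `D m n = 0` the displacement constraint as two linear equations. -/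
def staticConstraint : S.StaticIndex ⊕ S.StaticIndex → UAVPoint K L M N → ℝ
  | .inl p, z => z.x p.1.1 (nextEpisode p.1.2) - z.x p.1.1 (thisEpisode p.1.2)
  | .inr p, z => z.y p.1.1 (nextEpisode p.1.2) - z.y p.1.1 (thisEpisode p.1.2)

/-- The KKT conditions of the original problem when the displacement constraints with
`D m n = 0` (whose squared form has zero gradient at every feasible point) are expressed by linear
equations. If there are no such pairs, these are the conditions of `IsKKT`. -/
def IsKKTStatic (z : UAVPoint K L M N) : Prop :=
  IsKKTPoint UAVPoint.R S.constraint S.staticConstraint z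

end UAVSystem

/-!
Since `invApprox c ct ≤ 1 / c`, with equality at `c = ct`, a point feasible for a linearized problem
is feasible for the original one, and hence for the problem linearized at that point itself. So
every iterate competes in the next iteration, and the objective values increase; they are bounded
because the altitude forces `c ≤ 1 / H ^ 2`.

The Karush-Kuhn-Tucker conditions come from points `w` that are optimal for the problem linearized
at `w.c`: there the two problems have the same constraint values and gradients
(`hasFDerivAt_approxConstraint`), optimality rules out directions of increase of `R` that strictly
decrease the active constraints, and `exists_multipliers_of_forall_descent` turns this into
multipliers, normalized with the help of `exists_descent_direction`. The displacement constraints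
with `D m n = 0` get the multiplier `0`; their role is played by the linear equations.

A cluster point with `c > 0` is such a point (`isApproxSolution_of_mapClusterPt`): a competitor for
its linearization can be perturbed into one for the linearizations at nearby iterates, whose optimal
values never exceed the limit of the objective. If instead the objective stagnates in iteration `q`,
then `z (q - 1)` is such a point, but `z q` may differ from it. By strict convexity in the
locations (`IsApproxSolution.location_eq`) and strict monotonicity of the rates, the two iterates
differ only in auxiliary variables of users all of whose multipliers vanish
(`IsMultiplier.aux_eq_zero_iff`), so the multipliers of `z (q - 1)` are also multipliers at `z q`.
-/

/-! ### Multipliers from a separation argument -/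

/-- Motzkin's theorem of the alternative under a constraint qualification: if `f` has no direction
of increase among the strict descent directions of all `g i` inside the common kernel of the `h j`,
and such directions exist (`d₀`), then `f` is a combination of the `g i`, with nonnegative
coefficients, and of the `h j`. -/
theorem exists_multipliers_of_forall_descent {E ι κ : Type*} [AddCommGroup E] [Module ℝ E]
    [Fintype ι] [Fintype κ] (f : E →ₗ[ℝ] ℝ) (g : ι → E →ₗ[ℝ] ℝ) (h : κ → E →ₗ[ℝ] ℝ) (d₀ : E)
    (hg₀ : ∀ i, g i d₀ < 0) (hh₀ : ∀ j, h j d₀ = 0)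
    (hf : ∀ d, (∀ i, g i d < 0) → (∀ j, h j d = 0) → f d ≤ 0) :
    ∃ (u : ι → ℝ) (v : κ → ℝ), (∀ i, 0 ≤ u i) ∧ f = ∑ i, u i • g i + ∑ j, v j • h j := by
  classical
  let V : Submodule ℝ E := ⨅ j, LinearMap.ker (h j)
  have hV : ∀ d, d ∈ V ↔ ∀ j, h j d = 0 := fun d => by simp [V]
  let T : E →ₗ[ℝ] ℝ × (ι → ℝ) := f.prod (LinearMap.pi g)
  let W : Submodule ℝ (ℝ × (ι → ℝ)) := V.map T
  let O : Set (ℝ × (ι → ℝ)) := Set.Ioi 0 ×ˢ Set.univ.pi fun _ => Set.Iio 0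
  have hOo : IsOpen O := isOpen_Ioi.prod (isOpen_set_pi Set.finite_univ fun _ _ => isOpen_Iio)
  have hOc : Convex ℝ O := (convex_Ioi 0).prod (convex_pi fun _ _ => convex_Iio 0)
  have hdisj : Disjoint O (W : Set (ℝ × (ι → ℝ))) := by
    rw [Set.disjoint_left]
    rintro _ hO ⟨d, hd, rfl⟩
    simp only [O, Set.mem_prod, Set.mem_Ioi, Set.mem_pi, Set.mem_univ, true_imp_iff,
      Set.mem_Iio] at hO
    exact absurd (hf d hO.2 ((hV d).1 hd)) (not_le.2 hO.1)
  obtain ⟨F, s, hFO, hFW⟩ := geometric_hahn_banach_open hOc hOo W.convex hdisj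
  have hs : s ≤ 0 := by simpa using hFW 0 W.zero_mem
  -- a functional bounded below on a subspace vanishes there
  have hFW0 : ∀ p ∈ W, F p = 0 := by
    intro p hp
    by_contra hne
    have := hFW (((s - 1) / F p) • p) (W.smul_mem _ hp)
    rw [map_smul, smul_eq_mul, div_mul_cancel₀ _ hne] at this
    linarith
  have hone : ((1 : ℝ), fun _ : ι => (-1 : ℝ)) ∈ O := by simp [O]
  -- points of the closed orthant are limits of points of the open one
  have hFcl : ∀ p : ℝ × (ι → ℝ), 0 ≤ p.1 → (∀ i, p.2 i ≤ 0) → F p ≤ 0 := by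
    intro p hp1 hp2
    by_contra! hpos
    have h1 := hFO _ hone
    set e : ℝ × (ι → ℝ) := ((1 : ℝ), fun _ : ι => (-1 : ℝ))
    have ht : 0 < F p / (1 - F e) := div_pos hpos (by linarith)
    have hm : p + (F p / (1 - F e)) • e ∈ O := by
      simp only [O, Set.mem_prod, Set.mem_Ioi, Set.mem_pi, Set.mem_univ, true_imp_iff,
        Set.mem_Iio, e, Prod.fst_add, Prod.snd_add, Prod.smul_fst, Prod.smul_snd, Pi.add_apply,
        Pi.smul_apply, smul_eq_mul]
      exact ⟨by linarith, fun i => by linarith [hp2 i]⟩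
    have h2 := hFO _ hm
    rw [map_add, map_smul, smul_eq_mul] at h2
    have h3 : F p + F p / (1 - F e) * F e = F p / (1 - F e) := by
      have : 1 - F e ≠ 0 := by linarith
      field_simp
      ring
    linarith
  set α : ℝ := F (1, 0)
  set β : ι → ℝ := fun i => F (0, Pi.single i 1)
  have hα : α ≤ 0 := hFcl _ zero_le_one fun _ => le_rfl
  have hβ : ∀ i, 0 ≤ β i := by
    intro i
    have := hFcl (-(0, Pi.single i 1)) (by simp) fun k => by
      by_cases hk : k = i
      · subst hk; simp
      · simp [hk]
    rw [map_neg] at this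
    linarith
  have hF : ∀ p : ℝ × (ι → ℝ), F p = p.1 * α + ∑ i, p.2 i * β i := by
    intro p
    have : p = p.1 • ((1 : ℝ), (0 : ι → ℝ)) + ∑ i, p.2 i • ((0 : ℝ), Pi.single i (1 : ℝ)) := by
      ext k
      · simp [Prod.fst_sum]
      · simp [Prod.snd_sum, Finset.sum_apply, Pi.single_apply]
    conv_lhs => rw [this]
    simp only [map_add, map_sum, map_smul, smul_eq_mul, α, β]
  have hV0 : ∀ d ∈ V, f d * α + ∑ i, g i d * β i = 0 := fun d hd => by
    rw [← hFW0 _ (Submodule.mem_map_of_mem (f := T) hd), hF]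
    rfl
  have hα' : α < 0 := by
    refine lt_of_le_of_ne hα fun h0 => ?_
    have h1 := hV0 d₀ ((hV d₀).2 hh₀)
    rw [h0, mul_zero, zero_add, Finset.sum_eq_zero_iff_of_nonpos
      fun i _ => mul_nonpos_of_nonpos_of_nonneg (hg₀ i).le (hβ i)] at h1
    have h2 := hFO _ hone
    rw [hF] at h2
    have h3 : ∀ i, β i = 0 := fun i =>
      (mul_eq_zero.1 (h1 i (Finset.mem_univ i))).resolve_left (hg₀ i).ne
    simp [h0, h3] at h2
    linarith
  have hspan : f - ∑ i, (β i / -α) • g i ∈ Submodule.span ℝ (Set.range h) := by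
    refine mem_span_of_iInf_ker_le_ker fun d hd => ?_
    have h1 := hV0 d hd
    have h2 : ∑ i, β i / -α * g i d = (∑ i, g i d * β i) / -α := by
      rw [Finset.sum_div]
      exact Finset.sum_congr rfl fun i _ => by ring
    simp only [LinearMap.mem_ker, LinearMap.sub_apply, LinearMap.sum_apply, LinearMap.smul_apply,
      smul_eq_mul, h2]
    field_simp [hα'.ne]
    linarith
  obtain ⟨v, hv⟩ := (Submodule.mem_span_range_iff_exists_fun ℝ).1 hspan
  exact ⟨fun i => β i / -α, v, fun i => div_nonneg (hβ i) (by linarith), by rw [hv]; abel⟩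

/-- A real function that vanishes at `0` with negative derivative there is negative just after
`0`. -/
theorem HasDerivAt.eventually_neg_right {φ : ℝ → ℝ} {φ' : ℝ} (h : HasDerivAt φ φ' 0)
    (h0 : φ 0 = 0) (hneg : φ' < 0) : ∀ᶠ t in nhdsWithin 0 (Set.Ioi 0), φ t < 0 := by
  have h1 := h.tendsto_slope_zero_right
  filter_upwards [h1.eventually (gt_mem_nhds hneg), self_mem_nhdsWithin] with t ht htpos
  simp only [zero_add, h0, sub_zero, smul_eq_mul] at ht
  have := inv_pos.2 (Set.mem_Ioi.1 htpos)
  by_contra! hc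
  exact absurd ht (not_lt.2 (mul_nonneg this.le hc))

/-! ### The linearized constraint and the rate function -/

theorem invApprox_le_one_div {c ct : ℝ} (hc : 0 < c) (hct : 0 < ct) :
    invApprox c ct ≤ 1 / c := by
  have h : 1 / c - invApprox c ct = (c - ct) ^ 2 / (c * ct ^ 2) := by
    unfold invApprox
    field_simp
    ring
  have : 0 ≤ (c - ct) ^ 2 / (c * ct ^ 2) := by positivity
  linarith

/-- Solved for `c`, the linearized constraint on an auxiliary variable is an explicit bound. -/
theorem le_invApprox_iff {s c ct : ℝ} (hct : 0 < ct) :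
    s ≤ invApprox c ct ↔ c ≤ ct * (2 - ct * s) := by
  have h : invApprox c ct - s = (ct * (2 - ct * s) - c) / ct ^ 2 := by
    unfold invApprox
    field_simp
    ring
  rw [← sub_nonneg, h, le_div_iff₀ (by positivity), zero_mul, sub_nonneg]

@[simp] theorem invApprox_self (c : ℝ) : invApprox c c = 1 / c := by
  simp [invApprox]

namespace UAVSystem

variable {K L M N : ℕ} (S : UAVSystem K L M N)

/-- The signal-to-noise ratio per unit of `∑ m, c k l m n`. -/
noncomputable def gain : ℝ := S.P * S.τ₀ / (M * S.σ ^ 2 / ((M : ℝ) - K))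

theorem gain_pos (hKM : K < M) (hP : 0 < S.P) (hτ : 0 < S.τ₀) (hσ : 0 < S.σ) : 0 < S.gain := by
  have h1 : (0 : ℝ) < (M : ℝ) - K := sub_pos.2 (by exact_mod_cast hKM)
  have h2 : (0 : ℝ) < M := by exact_mod_cast (Nat.zero_le K).trans_lt hKM
  unfold gain
  positivity

theorem rate_eq (k : Fin K) (l : Fin L) (c : AuxVar K L M N) :
    S.rate k l c =
      1 / ((N : ℝ) * L) * ∑ n, Real.logb 2 (1 + S.gain * ∑ m, c k l m n) := by
  unfold rate gain
  simp only [mul_div_right_comm]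

variable {S}

theorem one_le_snr (hg : 0 < S.gain) {k : Fin K} {l : Fin L} {c : AuxVar K L M N}
    (hc : ∀ m n, 0 < c k l m n) (n : Fin N) : 1 ≤ 1 + S.gain * ∑ m, c k l m n :=
  le_add_of_nonneg_right (mul_nonneg hg.le (Finset.sum_nonneg fun m _ => (hc m n).le))

theorem rate_mono (hg : 0 < S.gain) {k : Fin K} {l : Fin L} {c c' : AuxVar K L M N}
    (hc : ∀ m n, 0 < c k l m n) (hcc : ∀ m n, c k l m n ≤ c' k l m n) :
    S.rate k l c ≤ S.rate k l c' := by
  rw [rate_eq, rate_eq]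
  refine mul_le_mul_of_nonneg_left (Finset.sum_le_sum fun n _ => ?_) (by positivity)
  refine Real.logb_le_logb_of_le one_lt_two (zero_lt_one.trans_le (one_le_snr hg hc n)) ?_
  gcongr with m _
  exact hcc m n

/-- The rate of a user is strictly increasing in the auxiliary variables of that user. -/
theorem rate_lt_rate (hg : 0 < S.gain) {k : Fin K} {l : Fin L} {c c' : AuxVar K L M N}
    (hc : ∀ m n, 0 < c k l m n) (hcc : ∀ m n, c k l m n ≤ c' k l m n)
    {m : Fin M} {n : Fin N} (hlt : c k l m n < c' k l m n) :
    S.rate k l c < S.rate k l c' := by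
  have hN : (0 : ℝ) < N := by exact_mod_cast n.pos
  have hL : (0 : ℝ) < L := by exact_mod_cast l.pos
  rw [rate_eq, rate_eq]
  refine mul_lt_mul_of_pos_left (Finset.sum_lt_sum (fun n _ => ?_) ⟨n, Finset.mem_univ n, ?_⟩)
    (by positivity)
  · refine Real.logb_le_logb_of_le one_lt_two (zero_lt_one.trans_le (one_le_snr hg hc n)) ?_
    gcongr with m _
    exact hcc m n
  · refine Real.logb_lt_logb one_lt_two (zero_lt_one.trans_le (one_le_snr hg hc n)) ?_
    have := Finset.sum_lt_sum (fun m _ => hcc m n) ⟨m, Finset.mem_univ m, hlt⟩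
    gcongr

theorem eq_of_le_of_rate_le (hg : 0 < S.gain) {k : Fin K} {l : Fin L} {c c' : AuxVar K L M N}
    (hc : ∀ m n, 0 < c k l m n) (hcc : ∀ m n, c k l m n ≤ c' k l m n)
    (hr : S.rate k l c' ≤ S.rate k l c) : c k l = c' k l := by
  funext m n
  by_contra hne
  exact absurd (rate_lt_rate hg hc hcc (lt_of_le_of_ne (hcc m n) hne)) (not_lt.2 hr)

/-! ### Gradients of the constraints -/

/-- The coordinate `c k l m n` as a continuous linear form. -/
def auxCoord (k : Fin K) (l : Fin L) (m : Fin M) (n : Fin N) : AuxVar K L M N →L[ℝ] ℝ where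
  toFun c := c k l m n
  map_add' _ _ := rfl
  map_smul' _ _ := rfl
  cont := by fun_prop

@[simp] theorem auxCoord_apply (k : Fin K) (l : Fin L) (m : Fin M) (n : Fin N)
    (c : AuxVar K L M N) : auxCoord k l m n c = c k l m n := rfl

/-- The coordinate `x m n` as a continuous linear form. -/
def xCoord (m : Fin M) (n : Fin N) : UAVPoint K L M N →L[ℝ] ℝ :=
  ((ContinuousLinearMap.proj n).comp
    (ContinuousLinearMap.proj (φ := fun _ : Fin M => Fin N → ℝ) m)).comp
      (ContinuousLinearMap.fst ℝ _ _)

/-- The coordinate `y m n` as a continuous linear form. -/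
def yCoord (m : Fin M) (n : Fin N) : UAVPoint K L M N →L[ℝ] ℝ :=
  ((ContinuousLinearMap.proj n).comp
    (ContinuousLinearMap.proj (φ := fun _ : Fin M => Fin N → ℝ) m)).comp
      ((ContinuousLinearMap.fst ℝ _ _).comp (ContinuousLinearMap.snd ℝ _ _))

/-- The projection to the auxiliary variables as a continuous linear map. -/
def auxPart : UAVPoint K L M N →L[ℝ] AuxVar K L M N :=
  (ContinuousLinearMap.fst ℝ _ _).comp
    ((ContinuousLinearMap.snd ℝ _ _).comp (ContinuousLinearMap.snd ℝ _ _))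

/-- The objective as a continuous linear form. -/
def objCoord : UAVPoint K L M N →L[ℝ] ℝ :=
  (ContinuousLinearMap.snd ℝ _ _).comp
    ((ContinuousLinearMap.snd ℝ _ _).comp (ContinuousLinearMap.snd ℝ _ _))

@[simp] theorem xCoord_apply (m : Fin M) (n : Fin N) (z : UAVPoint K L M N) :
    xCoord m n z = z.x m n := rfl
@[simp] theorem yCoord_apply (m : Fin M) (n : Fin N) (z : UAVPoint K L M N) :
    yCoord m n z = z.y m n := rfl
@[simp] theorem auxPart_apply (z : UAVPoint K L M N) : auxPart z = z.c := rfl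
@[simp] theorem objCoord_apply (z : UAVPoint K L M N) : objCoord z = z.R := rfl

variable (S)

/-- The gradient of `rate k l` at `c`. -/
noncomputable def rateDeriv (k : Fin K) (l : Fin L) (c : AuxVar K L M N) :
    AuxVar K L M N →L[ℝ] ℝ :=
  (1 / ((N : ℝ) * L)) • ∑ n,
    (S.gain / ((1 + S.gain * ∑ m, c k l m n) * Real.log 2)) • ∑ m, auxCoord k l m n

/-- The gradients at `z` of the constraints of the original problem. -/
noncomputable def constraintDeriv :
    ConstraintIndex K L M N → UAVPoint K L M N → UAVPoint K L M N →L[ℝ] ℝ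
  | .inl (k, l), z => objCoord - (S.rateDeriv k l z.c).comp auxPart
  | .inr (.inl (k, l, m, n)), z => (2 * (z.x m n - S.a k l n)) • xCoord m n +
      (2 * (z.y m n - S.b k l n)) • yCoord m n +
      (1 / z.c k l m n ^ 2) • (auxCoord k l m n).comp auxPart
  | .inr (.inr (m, n)), z =>
      (2 * (z.x m (nextEpisode n) - z.x m (thisEpisode n))) •
        (xCoord m (nextEpisode n) - xCoord m (thisEpisode n)) +
      (2 * (z.y m (nextEpisode n) - z.y m (thisEpisode n))) •
        (yCoord m (nextEpisode n) - yCoord m (thisEpisode n))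

variable {S}

theorem hasFDerivAt_rate (hg : 0 < S.gain) {k : Fin K} {l : Fin L} {c : AuxVar K L M N}
    (hc : ∀ m n, 0 < c k l m n) : HasFDerivAt (S.rate k l) (S.rateDeriv k l c) c := by
  have h1 : S.rate k l = fun c : AuxVar K L M N =>
      1 / ((N : ℝ) * L) * ∑ n, Real.log (1 + S.gain * ∑ m, auxCoord k l m n c) / Real.log 2 :=
    funext fun c => S.rate_eq k l c
  rw [h1]
  refine HasFDerivAt.const_mul (HasFDerivAt.fun_sum fun n _ => ?_) _
  have h2 : HasFDerivAt (fun c : AuxVar K L M N => 1 + S.gain * ∑ m, auxCoord k l m n c)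
      (S.gain • ∑ m, auxCoord k l m n) c :=
    ((HasFDerivAt.fun_sum fun m _ => (auxCoord k l m n).hasFDerivAt).const_mul _).const_add _
  have h3 := (h2.log (zero_lt_one.trans_le (one_le_snr hg hc n)).ne').mul_const (Real.log 2)⁻¹
  simp only [div_eq_mul_inv]
  refine h3.congr_fderiv ?_
  rw [smul_smul, smul_smul]
  congr 1
  simp only [auxCoord_apply, mul_inv]
  ring

theorem hasFDerivAt_sub_sq {E : Type*} [NormedAddCommGroup E] [NormedSpace ℝ E]
    (f : E →L[ℝ] ℝ) (a : ℝ) (z : E) :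
    HasFDerivAt (fun z => (f z - a) ^ 2) ((2 * (f z - a)) • f) z := by
  have h := (f.hasFDerivAt (x := z)).sub_const a |>.pow 2
  exact h.congr_fderiv (by simp)

theorem hasFDerivAt_distSq (k : Fin K) (l : Fin L) (m : Fin M) (n : Fin N)
    (z : UAVPoint K L M N) :
    HasFDerivAt (S.distSq k l m n) ((2 * (z.x m n - S.a k l n)) • xCoord m n +
      (2 * (z.y m n - S.b k l n)) • yCoord m n) z :=
  ((hasFDerivAt_sub_sq (xCoord m n) _ z).add (hasFDerivAt_sub_sq (yCoord m n) _ z)).add_const _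

theorem hasFDerivAt_move (m : Fin M) (n : Fin (N - 1)) (z : UAVPoint K L M N) :
    HasFDerivAt (fun z => z.moveSq m n - S.D m n ^ 2)
      (S.constraintDeriv (.inr (.inr (m, n))) z) z := by
  have h := ((hasFDerivAt_sub_sq
    (xCoord m (nextEpisode n) - xCoord m (thisEpisode n) : UAVPoint K L M N →L[ℝ] ℝ) 0 z).add
    (hasFDerivAt_sub_sq (yCoord m (nextEpisode n) - yCoord m (thisEpisode n)) 0 z)).sub_const
      (S.D m n ^ 2)
  refine (h.congr_fderiv ?_).congr_of_eventuallyEq (.of_eq ?_)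
  · simp [constraintDeriv]
  · funext z
    simp [UAVPoint.moveSq]

theorem hasFDerivAt_constraint (hg : 0 < S.gain) {z : UAVPoint K L M N}
    (hc : ∀ k l m n, 0 < z.c k l m n) (i : ConstraintIndex K L M N) :
    HasFDerivAt (S.constraint i) (S.constraintDeriv i z) z := by
  rcases i with ⟨k, l⟩ | ⟨k, l, m, n⟩ | ⟨m, n⟩
  · exact objCoord.hasFDerivAt.sub
      ((hasFDerivAt_rate hg (hc k l)).comp (f := auxPart) z auxPart.hasFDerivAt)
  · have h := HasDerivAt.comp_hasFDerivAt (f := (auxCoord k l m n).comp auxPart) z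
      (hasDerivAt_inv (hc k l m n).ne')
      (((auxCoord k l m n).comp auxPart).hasFDerivAt (x := z))
    have h' := (S.hasFDerivAt_distSq k l m n z).sub h
    refine (h'.congr_fderiv ?_).congr_of_eventuallyEq (.of_eq ?_)
    · simp only [constraintDeriv, neg_smul, sub_neg_eq_add, one_div]
      rfl
    · funext z
      simp [constraint]
  · exact hasFDerivAt_move m n z

/-- The linearized problem at `z.c` has the same constraint gradients at `z` as the original
problem. -/
theorem hasFDerivAt_approxConstraint (hg : 0 < S.gain) {z : UAVPoint K L M N}
    (hc : ∀ k l m n, 0 < z.c k l m n) (i : ConstraintIndex K L M N) :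
    HasFDerivAt (S.approxConstraint z.c i) (S.constraintDeriv i z) z := by
  rcases i with ⟨k, l⟩ | ⟨k, l, m, n⟩ | ⟨m, n⟩
  · exact hasFDerivAt_constraint hg hc (.inl (k, l))
  · have h := ((((auxCoord k l m n).comp auxPart).hasFDerivAt (x := z)).sub_const
      (z.c k l m n)).const_mul (1 / z.c k l m n ^ 2) |>.const_sub (1 / z.c k l m n)
    have h' := (S.hasFDerivAt_distSq k l m n z).sub h
    exact h'.congr_fderiv (by simp only [constraintDeriv, sub_neg_eq_add])
  · exact hasFDerivAt_move m n z

theorem approxConstraint_self (z : UAVPoint K L M N) (i : ConstraintIndex K L M N) :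
    S.approxConstraint z.c i z = S.constraint i z := by
  rcases i with ⟨k, l⟩ | ⟨k, l, m, n⟩ | ⟨m, n⟩ <;> simp [approxConstraint, constraint]

/-! ### Optimality for its own linearization implies the Karush-Kuhn-Tucker conditions -/

variable (S) in
/-- The linear equations replacing the displacement constraints with `D m n = 0`, as continuous
linear forms. -/
def staticForm : S.StaticIndex ⊕ S.StaticIndex → UAVPoint K L M N →L[ℝ] ℝ
  | .inl p => xCoord p.1.1 (nextEpisode p.1.2) - xCoord p.1.1 (thisEpisode p.1.2)
  | .inr p => yCoord p.1.1 (nextEpisode p.1.2) - yCoord p.1.1 (thisEpisode p.1.2)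

theorem staticConstraint_eq (j : S.StaticIndex ⊕ S.StaticIndex) :
    S.staticConstraint j = S.staticForm j := by
  rcases j with p | p <;> rfl

variable (S) in
/-- `(u, v)` are Lagrange multipliers of the original problem at `w`. -/
def IsMultiplier (w : UAVPoint K L M N) (u : ConstraintIndex K L M N → ℝ)
    (v : S.StaticIndex ⊕ S.StaticIndex → ℝ) : Prop :=
  (∀ i, 0 ≤ u i) ∧ (∀ i, u i * S.constraint i w = 0) ∧
    objCoord = ∑ i, u i • S.constraintDeriv i w + ∑ j, v j • S.staticForm j

theorem staticForm_eq_zero {w : UAVPoint K L M N} (hw : ∀ i, S.constraint i w ≤ 0)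
    (j : S.StaticIndex ⊕ S.StaticIndex) : S.staticForm j w = 0 := by
  have key : ∀ p : S.StaticIndex, w.moveSq p.1.1 p.1.2 ≤ 0 := fun p => by
    have := hw (.inr (.inr p.1))
    simpa [constraint, p.2] using this
  rcases j with p | p
  · have := key p
    simp only [UAVPoint.moveSq] at this
    simp only [staticForm, sub_apply, xCoord_apply]
    nlinarith
  · have := key p
    simp only [UAVPoint.moveSq] at this
    simp only [staticForm, sub_apply, yCoord_apply]
    nlinarith

theorem IsMultiplier.isKKTStatic (hg : 0 < S.gain) {w : UAVPoint K L M N}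
    (hc : ∀ k l m n, 0 < w.c k l m n) (hw : ∀ i, S.constraint i w ≤ 0)
    {u : ConstraintIndex K L M N → ℝ} {v : S.StaticIndex ⊕ S.StaticIndex → ℝ}
    (h : S.IsMultiplier w u v) : S.IsKKTStatic w := by
  have hR : HasFDerivAt UAVPoint.R (objCoord : UAVPoint K L M N →L[ℝ] ℝ) w :=
    objCoord.hasFDerivAt
  have hi := hasFDerivAt_constraint hg hc
  have hj : ∀ j, HasFDerivAt (S.staticConstraint j) (S.staticForm j) w := fun j => by
    rw [staticConstraint_eq]
    exact (S.staticForm j).hasFDerivAt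
  refine ⟨hR.differentiableAt, fun i => (hi i).differentiableAt, fun j => (hj j).differentiableAt,
    hw, fun j => ?_, u, v, h.1, h.2.1, ?_⟩
  · rw [staticConstraint_eq]
    exact staticForm_eq_zero hw j
  · simp only [hR.fderiv, (hi _).fderiv, (hj _).fderiv]
    exact h.2.2

/-- The direction behind the constraint qualification: contracting the trajectories towards the
origin strictly decreases every displacement that is not forced to vanish, and lowering first `c`
and then `R` takes care of the other constraints. -/
theorem exists_descent_direction {w : UAVPoint K L M N} (hc : ∀ k l m n, 0 < w.c k l m n)
    (hw : ∀ i, S.constraint i w ≤ 0) : ∃ d : UAVPoint K L M N,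
      (∀ i, S.constraint i w = 0 → (∀ p : S.StaticIndex, i ≠ .inr (.inr p.1)) →
        S.constraintDeriv i w d < 0) ∧ ∀ j, S.staticForm j d = 0 := by
  set dc : AuxVar K L M N := fun k l m n => w.c k l m n ^ 2 *
    (2 * (w.x m n - S.a k l n) * w.x m n + 2 * (w.y m n - S.b k l n) * w.y m n - 1) with hdc
  obtain ⟨B, hB⟩ := (Set.finite_range fun p : Fin K × Fin L => S.rateDeriv p.1 p.2 w.c dc).bddBelow
  refine ⟨(-w.x, -w.y, dc, B - 1), ?_, fun j => ?_⟩
  · rintro (⟨k, l⟩ | ⟨k, l, m, n⟩ | ⟨m, n⟩) h0 hns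
    · have := hB ⟨(k, l), rfl⟩
      have h2 : S.constraintDeriv (.inl (k, l)) w (-w.x, -w.y, dc, B - 1) =
        B - 1 - S.rateDeriv k l w.c dc := rfl
      simp only at this
      linarith
    · have h2 : S.constraintDeriv (.inr (.inl (k, l, m, n))) w (-w.x, -w.y, dc, B - 1) =
        2 * (w.x m n - S.a k l n) * -w.x m n + 2 * (w.y m n - S.b k l n) * -w.y m n +
          1 / w.c k l m n ^ 2 * dc k l m n := rfl
      have := (hc k l m n).ne'
      have h3 : 1 / w.c k l m n ^ 2 * dc k l m n = 2 * (w.x m n - S.a k l n) * w.x m n +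
          2 * (w.y m n - S.b k l n) * w.y m n - 1 := by
        simp only [hdc]
        field_simp
      rw [h2, h3]
      linarith
    · have h2 : S.constraintDeriv (.inr (.inr (m, n))) w (-w.x, -w.y, dc, B - 1) =
        2 * (w.x m (nextEpisode n) - w.x m (thisEpisode n)) *
          (-w.x m (nextEpisode n) - -w.x m (thisEpisode n)) +
        2 * (w.y m (nextEpisode n) - w.y m (thisEpisode n)) *
          (-w.y m (nextEpisode n) - -w.y m (thisEpisode n)) := rfl
      have h3 : w.moveSq m n = S.D m n ^ 2 := sub_eq_zero.1 h0
      have h4 : S.D m n ≠ 0 := fun h => hns ⟨(m, n), h⟩ rfl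
      have h5 : 0 < S.D m n ^ 2 := by positivity
      rw [h2]
      simp only [UAVPoint.moveSq] at h3
      nlinarith
  · have := staticForm_eq_zero hw j
    rcases j with p | p
    · have h2 : S.staticForm (.inl p) (-w.x, -w.y, dc, B - 1) =
        -w.x p.1.1 (nextEpisode p.1.2) - -w.x p.1.1 (thisEpisode p.1.2) := rfl
      simp only [staticForm, sub_apply, xCoord_apply] at this
      rw [h2]
      linarith
    · have h2 : S.staticForm (.inr p) (-w.x, -w.y, dc, B - 1) =
        -w.y p.1.1 (nextEpisode p.1.2) - -w.y p.1.1 (thisEpisode p.1.2) := rfl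
      simp only [staticForm, sub_apply, yCoord_apply] at this
      rw [h2]
      linarith

/-- The objective does not increase along a direction that strictly decreases the active
constraints. -/
theorem IsApproxSolution.objCoord_nonpos (hg : 0 < S.gain) {w : UAVPoint K L M N}
    (hw : S.IsApproxSolution w.c w) {d : UAVPoint K L M N}
    (hd : ∀ i, S.constraint i w = 0 → (∀ p : S.StaticIndex, i ≠ .inr (.inr p.1)) →
      S.constraintDeriv i w d < 0) (hd' : ∀ j, S.staticForm j d = 0) : objCoord d ≤ 0 := by
  by_contra! hpos
  have hline : HasDerivAt (fun t : ℝ => w + t • d) d 0 := by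
    simpa using ((hasDerivAt_id (0 : ℝ)).smul_const d).const_add w
  have hcont : Filter.Tendsto (fun t : ℝ => w + t • d) (nhdsWithin 0 (Set.Ioi 0)) (nhds w) := by
    have := hline.continuousAt.tendsto
    rw [zero_smul, add_zero] at this
    exact this.mono_left nhdsWithin_le_nhds
  have hw0 : ∀ i, S.constraint i w ≤ 0 := fun i => by
    rw [← approxConstraint_self]
    exact hw.1.2 i
  have h1 : ∀ i, ∀ᶠ t in nhdsWithin (0 : ℝ) (Set.Ioi 0),
      S.approxConstraint w.c i (w + t • d) ≤ 0 := by
    intro i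
    have hi := hasFDerivAt_approxConstraint hg hw.1.1 i
    rcases (hw0 i).lt_or_eq with hlt | heq
    · rw [← approxConstraint_self] at hlt
      exact ((hi.continuousAt.tendsto.comp hcont).eventually (gt_mem_nhds hlt)).mono
        fun t ht => ht.le
    · by_cases hs : ∃ p : S.StaticIndex, i = .inr (.inr p.1)
      · obtain ⟨p, rfl⟩ := hs
        refine Filter.Eventually.of_forall fun t => ?_
        have hx : S.staticForm (.inl p) (w + t • d) = 0 := by
          rw [map_add, map_smul, hd', staticForm_eq_zero hw0, smul_zero, add_zero]
        have hy : S.staticForm (.inr p) (w + t • d) = 0 := by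
          rw [map_add, map_smul, hd', staticForm_eq_zero hw0, smul_zero, add_zero]
        have : S.approxConstraint w.c (.inr (.inr p.1)) (w + t • d) =
          S.staticForm (.inl p) (w + t • d) ^ 2 + S.staticForm (.inr p) (w + t • d) ^ 2 -
            S.D p.1.1 p.1.2 ^ 2 := rfl
        rw [this, hx, hy, p.2]
        simp
      · push Not at hs
        have h0 : w + (0 : ℝ) • d = w := by simp
        have hi' : HasDerivAt (fun t : ℝ => S.approxConstraint w.c i (w + t • d))
            (S.constraintDeriv i w d) 0 :=
          HasFDerivAt.comp_hasDerivAt (l := S.approxConstraint w.c i)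
            (f := fun t : ℝ => w + t • d) 0 (by simpa only [h0] using hi) hline
        refine (hi'.eventually_neg_right ?_ (hd i heq hs)).mono fun t ht => ht.le
        rw [h0, approxConstraint_self, heq]
  have h2 : ∀ k l m n, ∀ᶠ t in nhdsWithin (0 : ℝ) (Set.Ioi 0), 0 < (w + t • d).c k l m n :=
    fun k l m n => ((((auxCoord k l m n).comp auxPart).continuous.tendsto w).comp
      hcont).eventually (lt_mem_nhds (hw.1.1 k l m n))
  simp only [← Filter.eventually_all] at h1 h2
  have h2' : ∀ᶠ t in nhdsWithin (0 : ℝ) (Set.Ioi 0), ∀ k l m n, 0 < (w + t • d).c k l m n := by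
    simpa only [Filter.eventually_all] using h2
  obtain ⟨t, ht, htc, htpos⟩ := (h1.and (h2'.and self_mem_nhdsWithin)).exists
  have h3 := hw.2 _ ⟨htc, ht⟩
  have h4 : (w + t • d).R = w.R + t * objCoord d := rfl
  have := mul_pos (Set.mem_Ioi.1 htpos) hpos
  linarith

/-- A point that is optimal for the problem linearized at that very point has Lagrange multipliers
for the original problem. -/
theorem IsApproxSolution.exists_isMultiplier (hg : 0 < S.gain) {w : UAVPoint K L M N}
    (hw : S.IsApproxSolution w.c w) : ∃ u v, S.IsMultiplier w u v := by
  classical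
  have hw0 : ∀ i, S.constraint i w ≤ 0 := fun i => by
    rw [← approxConstraint_self]
    exact hw.1.2 i
  let A : ConstraintIndex K L M N → Prop := fun i =>
    S.constraint i w = 0 ∧ ∀ p : S.StaticIndex, i ≠ .inr (.inr p.1)
  obtain ⟨d₀, hd₀, hd₀'⟩ := exists_descent_direction hw.1.1 hw0
  obtain ⟨u, v, hu, huv⟩ := exists_multipliers_of_forall_descent
    (objCoord : UAVPoint K L M N →L[ℝ] ℝ).toLinearMap
    (fun i : {i // A i} => (S.constraintDeriv i.1 w).toLinearMap)
    (fun j => (S.staticForm j).toLinearMap) d₀ (fun i => hd₀ i.1 i.2.1 i.2.2) hd₀'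
    (fun d hd hd' => hw.objCoord_nonpos hg (fun i h1 h2 => hd ⟨i, h1, h2⟩) hd')
  refine ⟨fun i => if h : A i then u ⟨i, h⟩ else 0, v, fun i => ?_, fun i => ?_, ?_⟩
  · dsimp only
    split_ifs with h
    · exact hu _
    · exact le_rfl
  · dsimp only
    split_ifs with h
    · rw [h.1, mul_zero]
    · rw [zero_mul]
  · have hsum : ∑ i, (if h : A i then u ⟨i, h⟩ else 0) • S.constraintDeriv i w =
        ∑ i : {i // A i}, u i • S.constraintDeriv i.1 w := by
      refine (Fintype.sum_of_injective (Subtype.val : {i // A i} → ConstraintIndex K L M N)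
        Subtype.val_injective _ _ (fun i hi => ?_) fun i => ?_).symm
      · rw [dif_neg fun h => hi ⟨⟨i, h⟩, rfl⟩, zero_smul]
      · rw [dif_pos i.2]
    rw [hsum]
    refine ContinuousLinearMap.ext fun d => ?_
    have := LinearMap.congr_fun huv d
    simpa using this

/-! ### Uniqueness of the trajectories and transfer of multipliers -/

theorem rate_congr {k : Fin K} {l : Fin L} {c c' : AuxVar K L M N} (h : c k l = c' k l) :
    S.rate k l c = S.rate k l c' := by
  simp only [rate, h]

theorem rateDeriv_congr {k : Fin K} {l : Fin L} {c c' : AuxVar K L M N} (h : c k l = c' k l) :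
    S.rateDeriv k l c = S.rateDeriv k l c' := by
  simp only [rateDeriv, h]

/-- Midpoint concavity of the rate. -/
theorem rate_add_rate_le (hg : 0 < S.gain) {k : Fin K} {l : Fin L} {c c' : AuxVar K L M N}
    (hc : ∀ m n, 0 < c k l m n) (hc' : ∀ m n, 0 < c' k l m n) :
    (S.rate k l c + S.rate k l c') / 2 ≤
      S.rate k l fun k l m n => (c k l m n + c' k l m n) / 2 := by
  rw [rate_eq, rate_eq, rate_eq, ← mul_add, ← Finset.sum_add_distrib, mul_div_assoc,
    Finset.sum_div]
  refine mul_le_mul_of_nonneg_left (Finset.sum_le_sum fun n _ => ?_) (by positivity)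
  have h1 : 0 < 1 + S.gain * ∑ m, c k l m n := zero_lt_one.trans_le (one_le_snr hg hc n)
  have h2 : 0 < 1 + S.gain * ∑ m, c' k l m n := zero_lt_one.trans_le (one_le_snr hg hc' n)
  have h3 := strictConcaveOn_log_Ioi.concaveOn.2 (Set.mem_Ioi.2 h1) (Set.mem_Ioi.2 h2)
    (by norm_num : (0 : ℝ) ≤ 1 / 2) (by norm_num : (0 : ℝ) ≤ 1 / 2) (by norm_num)
  have h4 : (1 / 2 : ℝ) • (1 + S.gain * ∑ m, c k l m n) + (1 / 2 : ℝ) •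
      (1 + S.gain * ∑ m, c' k l m n) = 1 + S.gain * ∑ m, (c k l m n + c' k l m n) / 2 := by
    rw [← Finset.sum_div, Finset.sum_add_distrib, smul_eq_mul, smul_eq_mul]
    ring
  rw [h4, smul_eq_mul, smul_eq_mul] at h3
  have h5 : (0 : ℝ) < Real.log 2 := Real.log_pos one_lt_two
  simp only [Real.logb]
  rw [← add_div, div_div, mul_comm (Real.log 2), ← div_div]
  exact div_le_div_of_nonneg_right (by linarith) h5.le

/-- A linearized problem determines the locations: if two optimal solutions placed some UAV
differently, halfway between them all the squared distances to that UAV would drop strictly below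
the average, so the rates of all users could be improved at once. -/
theorem IsApproxSolution.location_eq (hg : 0 < S.gain) {ct : AuxVar K L M N}
    (hct : ∀ k l m n, 0 < ct k l m n) {z w : UAVPoint K L M N}
    (hz : S.IsApproxSolution ct z) (hw : S.IsApproxSolution ct w) (m : Fin M) (n : Fin N) :
    z.x m n = w.x m n ∧ z.y m n = w.y m n := by
  by_contra hne
  have hR : w.R = z.R := le_antisymm (hz.2 w hw.1) (hw.2 z hz.1)
  have hpos : 0 < (z.x m n - w.x m n) ^ 2 + (z.y m n - w.y m n) ^ 2 := by
    by_contra! h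
    exact hne ⟨by nlinarith, by nlinarith⟩
  let p : UAVPoint K L M N := (fun m n => (z.x m n + w.x m n) / 2,
    fun m n => (z.y m n + w.y m n) / 2, 0, 0)
  let cm : AuxVar K L M N := fun k l m n => (z.c k l m n + w.c k l m n) / 2
  let c : AuxVar K L M N := fun k l m n => ct k l m n * (2 - ct k l m n * S.distSq k l m n p)
  -- the parallelogram law for the distances to the midpoint
  have hdist : ∀ k l m n, S.distSq k l m n p = (S.distSq k l m n z + S.distSq k l m n w) / 2 -
      ((z.x m n - w.x m n) ^ 2 + (z.y m n - w.y m n) ^ 2) / 4 := by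
    intro k l m n
    have : S.distSq k l m n p = ((z.x m n + w.x m n) / 2 - S.a k l n) ^ 2 +
      ((z.y m n + w.y m n) / 2 - S.b k l n) ^ 2 + S.H ^ 2 := rfl
    rw [this]
    simp only [distSq]
    ring
  have hgap : ∀ k l m n, cm k l m n +
      ct k l m n ^ 2 * (((z.x m n - w.x m n) ^ 2 + (z.y m n - w.y m n) ^ 2) / 4) ≤ c k l m n := by
    intro k l m n
    have h1 := (le_invApprox_iff (hct k l m n)).1 (sub_nonpos.1 (hz.1.2 (.inr (.inl (k, l, m, n)))))
    have h2 := (le_invApprox_iff (hct k l m n)).1 (sub_nonpos.1 (hw.1.2 (.inr (.inl (k, l, m, n)))))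
    simp only [cm, c, hdist]
    linarith
  have hcm : ∀ k l m n, 0 < cm k l m n := fun k l m n => by
    have := hz.1.1 k l m n
    have := hw.1.1 k l m n
    simp only [cm]
    linarith
  have hcmc : ∀ k l m n, cm k l m n ≤ c k l m n := fun k l m n =>
    le_trans (le_add_of_nonneg_right (by positivity)) (hgap k l m n)
  have hrate : ∀ k l, z.R < S.rate k l c := by
    intro k l
    have h1 : z.R ≤ S.rate k l z.c := sub_nonpos.1 (hz.1.2 (.inl (k, l)))
    have h2 : w.R ≤ S.rate k l w.c := sub_nonpos.1 (hw.1.2 (.inl (k, l)))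
    have h3 := rate_add_rate_le hg (hz.1.1 k l) (hw.1.1 k l)
    have h4 : S.rate k l cm < S.rate k l c := rate_lt_rate hg (hcm k l) (hcmc k l)
      (lt_of_lt_of_le (lt_add_of_pos_right _ (by have := hct k l m n; positivity)) (hgap k l m n))
    have h5 : (S.rate k l z.c + S.rate k l w.c) / 2 ≤ S.rate k l cm := h3
    linarith
  have hev : ∀ᶠ r in nhdsWithin z.R (Set.Ioi z.R), ∀ k l, r < S.rate k l c := by
    simp only [Filter.eventually_all]
    exact fun k l => nhdsWithin_le_nhds (gt_mem_nhds (hrate k l))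
  obtain ⟨r, hr, hzr⟩ := (hev.and self_mem_nhdsWithin).exists
  have hfeas : ((p.x, p.y, c, r) : UAVPoint K L M N) ∈ S.approxFeasible ct := by
    refine ⟨fun k l m n => (hcm k l m n).trans_le (hcmc k l m n), ?_⟩
    rintro (⟨k, l⟩ | ⟨k, l, m, n⟩ | ⟨m, n⟩)
    · exact sub_nonpos.2 (hr k l).le
    · exact sub_nonpos.2 ((le_invApprox_iff (hct k l m n)).2 le_rfl)
    · have h1 := hz.1.2 (.inr (.inr (m, n)))
      have h2 := hw.1.2 (.inr (.inr (m, n)))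
      have h3 : S.approxConstraint ct (.inr (.inr (m, n))) (p.x, p.y, c, r) =
        ((z.x m (nextEpisode n) + w.x m (nextEpisode n)) / 2 -
          (z.x m (thisEpisode n) + w.x m (thisEpisode n)) / 2) ^ 2 +
        ((z.y m (nextEpisode n) + w.y m (nextEpisode n)) / 2 -
          (z.y m (thisEpisode n) + w.y m (thisEpisode n)) / 2) ^ 2 - S.D m n ^ 2 := rfl
      simp only [approxConstraint, UAVPoint.moveSq] at h1 h2
      rw [h3]
      nlinarith [sq_nonneg ((z.x m (nextEpisode n) - z.x m (thisEpisode n)) -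
          (w.x m (nextEpisode n) - w.x m (thisEpisode n))),
        sq_nonneg ((z.y m (nextEpisode n) - z.y m (thisEpisode n)) -
          (w.y m (nextEpisode n) - w.y m (thisEpisode n)))]
  exact absurd (hz.2 _ hfeas) (not_le.2 hzr)

/-- Stationarity with respect to `c k l m n`: the multiplier of the constraint on an auxiliary
variable is a positive multiple of the multiplier of the rate constraint of the same user. -/
theorem IsMultiplier.aux_eq_zero_iff (hg : 0 < S.gain) {w : UAVPoint K L M N}
    (hc : ∀ k l m n, 0 < w.c k l m n) {u : ConstraintIndex K L M N → ℝ}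
    {v : S.StaticIndex ⊕ S.StaticIndex → ℝ} (h : S.IsMultiplier w u v)
    (k : Fin K) (l : Fin L) (m : Fin M) (n : Fin N) :
    u (.inr (.inl (k, l, m, n))) = 0 ↔ u (.inl (k, l)) = 0 := by
  let e : AuxVar K L M N := Pi.single k (Pi.single l (Pi.single m (Pi.single n 1)))
  have he : ∀ k' l' m' n', e k' l' m' n' =
      if k' = k ∧ l' = l ∧ m' = m ∧ n' = n then 1 else 0 := by
    intro k' l' m' n'
    by_cases h1 : k' = k
    · subst h1
      by_cases h2 : l' = l
      · subst h2
        by_cases h3 : m' = m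
        · subst h3
          by_cases h4 : n' = n
          · subst h4; simp [e]
          · simp [e, h4]
        · simp [e, h3]
      · simp [e, h2]
    · simp [e, h1]
  have hrd : ∀ k' l', S.rateDeriv k' l' w.c e = 1 / ((N : ℝ) * L) * ∑ n',
      S.gain / ((1 + S.gain * ∑ m', w.c k' l' m' n') * Real.log 2) * ∑ m', e k' l' m' n' := by
    intro k' l'
    simp [rateDeriv]
  have hrd0 : ∀ p : Fin K × Fin L, p ≠ (k, l) → S.rateDeriv p.1 p.2 w.c e = 0 := by
    rintro ⟨k', l'⟩ hp
    have : ∀ m' n', e k' l' m' n' = 0 := fun m' n' => by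
      rw [he, if_neg]
      rintro ⟨rfl, rfl, -⟩
      exact hp rfl
    rw [hrd]
    simp [this]
  have hrdpos : 0 < S.rateDeriv k l w.c e := by
    have hN : (0 : ℝ) < N := by exact_mod_cast n.pos
    have hL : (0 : ℝ) < L := by exact_mod_cast l.pos
    have hlog : (0 : ℝ) < Real.log 2 := Real.log_pos one_lt_two
    have hsnr := fun n => zero_lt_one.trans_le (one_le_snr hg (hc k l) n)
    have henn : ∀ m' n', 0 ≤ e k l m' n' := fun m' n' => by
      rw [he]
      split_ifs <;> norm_num
    rw [hrd]
    refine mul_pos (by positivity) (Finset.sum_pos' (fun n' _ => mul_nonneg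
      (div_pos hg (mul_pos (hsnr n') hlog)).le (Finset.sum_nonneg fun m' _ => henn m' n'))
      ⟨n, Finset.mem_univ n, mul_pos (div_pos hg (mul_pos (hsnr n) hlog)) ?_⟩)
    exact Finset.sum_pos' (fun m' _ => henn m' n) ⟨m, Finset.mem_univ m, by simp [he]⟩
  have h1 := congrArg (fun f : UAVPoint K L M N →L[ℝ] ℝ => f (0, 0, e, 0)) h.2.2
  have hrt : ∀ p : Fin K × Fin L, S.constraintDeriv (.inl p) w (0, 0, e, 0) =
      -S.rateDeriv p.1 p.2 w.c e := fun p => zero_sub _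
  have hax : ∀ p : Fin K × Fin L × Fin M × Fin N,
      S.constraintDeriv (.inr (.inl p)) w (0, 0, e, 0) =
        1 / w.c p.1 p.2.1 p.2.2.1 p.2.2.2 ^ 2 * e p.1 p.2.1 p.2.2.1 p.2.2.2 := by
    intro p
    have : S.constraintDeriv (.inr (.inl p)) w (0, 0, e, 0) =
        2 * (w.x p.2.2.1 p.2.2.2 - S.a p.1 p.2.1 p.2.2.2) * 0 +
        2 * (w.y p.2.2.1 p.2.2.2 - S.b p.1 p.2.1 p.2.2.2) * 0 +
          1 / w.c p.1 p.2.1 p.2.2.1 p.2.2.2 ^ 2 * e p.1 p.2.1 p.2.2.1 p.2.2.2 := rfl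
    rw [this]
    ring
  have hmv : ∀ p : Fin M × Fin (N - 1),
      S.constraintDeriv (.inr (.inr p)) w (0, 0, e, 0) = 0 := by
    intro p
    have : S.constraintDeriv (.inr (.inr p)) w (0, 0, e, 0) =
        2 * (w.x p.1 (nextEpisode p.2) - w.x p.1 (thisEpisode p.2)) * (0 - 0) +
        2 * (w.y p.1 (nextEpisode p.2) - w.y p.1 (thisEpisode p.2)) * (0 - 0) := rfl
    rw [this]
    ring
  have hst : ∀ j, S.staticForm j (0, 0, e, 0) = 0 := by
    rintro (p | p) <;> exact sub_zero 0
  have hsum1 : ∑ p : Fin K × Fin L, u (.inl p) * S.rateDeriv p.1 p.2 w.c e =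
      u (.inl (k, l)) * S.rateDeriv k l w.c e :=
    Finset.sum_eq_single (k, l) (fun p _ hp => by rw [hrd0 p hp, mul_zero]) (by simp)
  have hsum2 : ∑ p : Fin K × Fin L × Fin M × Fin N, u (.inr (.inl p)) *
      (1 / w.c p.1 p.2.1 p.2.2.1 p.2.2.2 ^ 2 * e p.1 p.2.1 p.2.2.1 p.2.2.2) =
      u (.inr (.inl (k, l, m, n))) * (1 / w.c k l m n ^ 2) := by
    rw [Finset.sum_eq_single (k, l, m, n) (fun p _ hp => ?_) (by simp)]
    · simp [he]
    · obtain ⟨k', l', m', n'⟩ := p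
      dsimp only
      rw [he, if_neg, mul_zero, mul_zero]
      rintro ⟨rfl, rfl, rfl, rfl⟩
      exact hp rfl
  have h2 : (0 : ℝ) = -(u (.inl (k, l)) * S.rateDeriv k l w.c e) +
      u (.inr (.inl (k, l, m, n))) * (1 / w.c k l m n ^ 2) := by
    have h0 : objCoord ((0, 0, e, 0) : UAVPoint K L M N) = 0 := rfl
    rw [← hsum1, ← hsum2, ← h0, h1]
    simp only [add_apply, sum_apply, smul_apply, smul_eq_mul, Fintype.sum_sum_type, hrt, hax, hmv,
      hst, mul_zero, Finset.sum_const_zero, add_zero, mul_neg, Finset.sum_neg_distrib]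
  have h3 : 0 < 1 / w.c k l m n ^ 2 := by
    have := hc k l m n
    positivity
  constructor
  · intro h0
    rw [h0, zero_mul, add_zero, eq_comm, neg_eq_zero] at h2
    exact (mul_eq_zero.1 h2).resolve_right hrdpos.ne'
  · intro h0
    rw [h0, zero_mul, neg_zero, zero_add, eq_comm] at h2
    exact (mul_eq_zero.1 h2).resolve_right h3.ne'

theorem constraint_nonpos_of_mem_approxFeasible {ct : AuxVar K L M N}
    (hct : ∀ k l m n, 0 < ct k l m n) {z : UAVPoint K L M N} (hz : z ∈ S.approxFeasible ct)
    (i : ConstraintIndex K L M N) : S.constraint i z ≤ 0 := by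
  have h := hz.2 i
  rcases i with ⟨k, l⟩ | ⟨k, l, m, n⟩ | ⟨m, n⟩
  · exact h
  · exact sub_nonpos.2 ((sub_nonpos.1 h).trans
      (invApprox_le_one_div (hz.1 k l m n) (hct k l m n)))
  · exact h

theorem mem_approxFeasible_self {z : UAVPoint K L M N} (hc : ∀ k l m n, 0 < z.c k l m n)
    (hz : ∀ i, S.constraint i z ≤ 0) : z ∈ S.approxFeasible z.c :=
  ⟨hc, fun i => (approxConstraint_self z i).trans_le (hz i)⟩

/-- If the linearization at the feasible point `z` does not improve the objective, then `z` itself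
is optimal for it, and the multipliers of `z` serve for any other optimal solution `w`: the
locations agree, and so do the auxiliary variables of every user with a nonzero multiplier. -/
theorem IsApproxSolution.isKKTStatic_of_R_eq (hg : 0 < S.gain) {z w : UAVPoint K L M N}
    (hc : ∀ k l m n, 0 < z.c k l m n) (hz : ∀ i, S.constraint i z ≤ 0)
    (hw : S.IsApproxSolution z.c w) (hR : w.R = z.R) : S.IsKKTStatic w := by
  have hzs : S.IsApproxSolution z.c z :=
    ⟨mem_approxFeasible_self hc hz, fun p hp => (hw.2 p hp).trans_eq hR⟩
  obtain ⟨u, v, huv⟩ := hzs.exists_isMultiplier hg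
  have hx : w.x = z.x := funext fun m => funext fun n => (hw.location_eq hg hc hzs m n).1
  have hy : w.y = z.y := funext fun m => funext fun n => (hw.location_eq hg hc hzs m n).2
  have hdist : ∀ k l m n, S.distSq k l m n w = S.distSq k l m n z := fun k l m n => by
    simp only [distSq, hx, hy]
  have hcu : ∀ k l, u (.inl (k, l)) ≠ 0 → w.c k l = z.c k l := by
    intro k l hkl
    have hrate : S.rate k l z.c = z.R :=
      (sub_eq_zero.1 ((mul_eq_zero.1 (huv.2.1 (.inl (k, l)))).resolve_left hkl)).symm
    refine eq_of_le_of_rate_le hg (hw.1.1 k l) (fun m n => ?_) ?_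
    · have hne := mt (huv.aux_eq_zero_iff hg hc k l m n).1 hkl
      have hact : S.distSq k l m n z = 1 / z.c k l m n :=
        sub_eq_zero.1 ((mul_eq_zero.1 (huv.2.1 _)).resolve_left hne)
      have h1 := (le_invApprox_iff (hc k l m n)).1
        (sub_nonpos.1 (hw.1.2 (.inr (.inl (k, l, m, n)))))
      rw [hdist, hact, mul_one_div_cancel (hc k l m n).ne'] at h1
      linarith
    · rw [hrate, ← hR]
      exact sub_nonpos.1 (hw.1.2 (.inl (k, l)))
  have key : ∀ i, u i ≠ 0 → S.constraint i w = S.constraint i z ∧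
      S.constraintDeriv i w = S.constraintDeriv i z := by
    rintro (⟨k, l⟩ | ⟨k, l, m, n⟩ | ⟨m, n⟩) hi
    · have h := hcu k l hi
      simp only [constraint, constraintDeriv, hR, rate_congr h, rateDeriv_congr h, and_self]
    · have h := hcu k l (mt (huv.aux_eq_zero_iff hg hc k l m n).2 hi)
      simp only [constraint, constraintDeriv, hdist, h, hx, hy, and_self]
    · simp only [constraint, constraintDeriv, UAVPoint.moveSq, hx, hy, and_self]
  refine IsMultiplier.isKKTStatic hg hw.1.1 (constraint_nonpos_of_mem_approxFeasible hc hw.1)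
    (u := u) (v := v) ⟨huv.1, fun i => ?_, ?_⟩
  · by_cases hi : u i = 0
    · rw [hi, zero_mul]
    · rw [(key i hi).1, huv.2.1]
  · rw [huv.2.2]
    congr 1
    refine Finset.sum_congr rfl fun i _ => ?_
    by_cases hi : u i = 0
    · rw [hi, zero_smul, zero_smul]
    · rw [(key i hi).2]

/-! ### Runs of the procedure and their cluster points -/

theorem IsRun.linPoint_pos {c₀ : AuxVar K L M N} {z : ℕ → UAVPoint K L M N} {Q : ℕ}
    (h : S.IsRun c₀ z Q) {q : ℕ} (hq : q ≤ Q + 1) (k : Fin K) (l : Fin L) (m : Fin M)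
    (n : Fin N) : 0 < linPoint c₀ z q k l m n := by
  unfold linPoint
  split_ifs with h1
  · exact h.1 k l m n
  · exact (h.2 (q - 1) (by omega) (by omega)).1.1 k l m n

theorem IsRun.constraint_nonpos {c₀ : AuxVar K L M N} {z : ℕ → UAVPoint K L M N} {Q : ℕ}
    (h : S.IsRun c₀ z Q) {q : ℕ} (hq : 1 ≤ q) (hqQ : q ≤ Q) (i : ConstraintIndex K L M N) :
    S.constraint i (z q) ≤ 0 :=
  constraint_nonpos_of_mem_approxFeasible (h.linPoint_pos (by omega)) (h.2 q hq hqQ).1 i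

theorem IsRun.aux_pos {c₀ : AuxVar K L M N} {z : ℕ → UAVPoint K L M N} {Q : ℕ}
    (h : S.IsRun c₀ z Q) {q : ℕ} (hq : 1 ≤ q) (hqQ : q ≤ Q) (k : Fin K) (l : Fin L) (m : Fin M)
    (n : Fin N) : 0 < (z q).c k l m n :=
  (h.2 q hq hqQ).1.1 k l m n

theorem IsRun.isApproxSolution_succ {c₀ : AuxVar K L M N} {z : ℕ → UAVPoint K L M N} {Q : ℕ}
    (h : S.IsRun c₀ z Q) {q : ℕ} (hq : 1 ≤ q) (hqQ : q + 1 ≤ Q) :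
    S.IsApproxSolution (z q).c (z (q + 1)) := by
  have := h.2 (q + 1) (by omega) hqQ
  rwa [linPoint, if_neg (by omega), Nat.add_sub_cancel] at this

/-- Each iterate is feasible for the next linearized problem. -/
theorem IsRun.R_le_R_succ {c₀ : AuxVar K L M N} {z : ℕ → UAVPoint K L M N} {Q : ℕ}
    (h : S.IsRun c₀ z Q) {q : ℕ} (hq : 1 ≤ q) (hqQ : q + 1 ≤ Q) : (z q).R ≤ (z (q + 1)).R :=
  (h.isApproxSolution_succ hq hqQ).2 _ (mem_approxFeasible_self
    (h.aux_pos hq (by omega)) (h.constraint_nonpos hq (by omega)))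

/-- The altitude bounds the auxiliary variables, and with them the objective, at all feasible
points. -/
theorem R_le_rate_of_constraint_nonpos (hg : 0 < S.gain) (hH : 0 < S.H) {z : UAVPoint K L M N}
    (hc : ∀ k l m n, 0 < z.c k l m n) (hz : ∀ i, S.constraint i z ≤ 0) (k : Fin K) (l : Fin L) :
    z.R ≤ S.rate k l fun _ _ _ _ => 1 / S.H ^ 2 := by
  refine (sub_nonpos.1 (hz (.inl (k, l)))).trans (rate_mono hg (hc k l) fun m n => ?_)
  have h1 : S.distSq k l m n z ≤ 1 / z.c k l m n := sub_nonpos.1 (hz (.inr (.inl (k, l, m, n))))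
  have h2 : S.H ^ 2 ≤ S.distSq k l m n z := le_add_of_nonneg_left (by positivity)
  exact (le_one_div (by positivity) (hc k l m n)).1 (h2.trans h1)

theorem monotone_R_of_isRun {c₀ : AuxVar K L M N} {z : ℕ → UAVPoint K L M N}
    (h : ∀ Q, S.IsRun c₀ z Q) : Monotone fun q => (z (q + 1)).R :=
  monotone_nat_of_le_succ fun q => (h (q + 2)).R_le_R_succ (by omega) le_rfl

/-- A cluster point `w` with `w.c > 0` of an infinite run is optimal for its own linearization.
A better point `p` could be turned into a point feasible for the problems linearized at nearby
iterates, by lowering `p.c` slightly where needed, and the next iterate would exceed `w.R`. -/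
theorem isApproxSolution_of_mapClusterPt (hg : 0 < S.gain) {c₀ : AuxVar K L M N}
    {z : ℕ → UAVPoint K L M N} (h : ∀ Q, S.IsRun c₀ z Q) {w : UAVPoint K L M N}
    (hw : MapClusterPt w Filter.atTop z) (hc : ∀ k l m n, 0 < w.c k l m n) :
    S.IsApproxSolution w.c w := by
  obtain ⟨ψ, hψ, hlim⟩ := hw.tendsto_subseq
  have hψ1 : ∀ᶠ j in Filter.atTop, 1 ≤ ψ j := hψ.tendsto_atTop.eventually_ge_atTop 1
  have hle : ∀ q, 1 ≤ q → (z q).R ≤ w.R := by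
    intro q hq
    have hRlim : Filter.Tendsto (fun j => (z (ψ j)).R) Filter.atTop (nhds w.R) :=
      (objCoord.continuous.tendsto w).comp hlim
    refine ge_of_tendsto hRlim ?_
    filter_upwards [hψ.tendsto_atTop.eventually_ge_atTop q] with j hj
    have := monotone_R_of_isRun h (show q - 1 ≤ ψ j - 1 by omega)
    simpa only [Nat.sub_add_cancel hq, Nat.sub_add_cancel (hq.trans hj)] using this
  have hfeas : ∀ i, S.constraint i w ≤ 0 := fun i => by
    refine le_of_tendsto ((hasFDerivAt_constraint hg hc i).continuousAt.tendsto.comp hlim) ?_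
    filter_upwards [hψ1] with j hj
    exact (h (ψ j)).constraint_nonpos hj le_rfl i
  refine ⟨mem_approxFeasible_self hc hfeas, fun p hp => ?_⟩
  by_contra! hlt
  let G : AuxVar K L M N → AuxVar K L M N := fun ct k l m n =>
    min (p.c k l m n) (ct k l m n * (2 - ct k l m n * S.distSq k l m n p))
  have hG : Continuous G := by fun_prop
  have hGw : G w.c = p.c := by
    funext k l m n
    exact min_eq_left
      ((le_invApprox_iff (hc k l m n)).1 (sub_nonpos.1 (hp.2 (.inr (.inl (k, l, m, n))))))
  have hclim : Filter.Tendsto (fun j => G (z (ψ j)).c) Filter.atTop (nhds p.c) := by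
    rw [← hGw]
    exact (hG.tendsto w.c).comp ((auxPart.continuous.tendsto w).comp hlim)
  obtain ⟨r, hr1, hr2⟩ := exists_between hlt
  have hpos : ∀ᶠ j in Filter.atTop, ∀ k l m n, 0 < G (z (ψ j)).c k l m n := by
    simp only [Filter.eventually_all]
    exact fun k l m n => (((auxCoord k l m n).continuous.tendsto p.c).comp hclim).eventually
      (lt_mem_nhds (hp.1 k l m n))
  have hrate : ∀ᶠ j in Filter.atTop, ∀ k l, r < S.rate k l (G (z (ψ j)).c) := by
    simp only [Filter.eventually_all]
    exact fun k l => ((hasFDerivAt_rate hg (hp.1 k l)).continuousAt.tendsto.comp hclim).eventually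
      (lt_mem_nhds (hr2.trans_le (sub_nonpos.1 (hp.2 (.inl (k, l))))))
  obtain ⟨j, hj, hjpos, hjrate⟩ := (hψ1.and (hpos.and hrate)).exists
  have hmem : ((p.x, p.y, G (z (ψ j)).c, r) : UAVPoint K L M N) ∈
      S.approxFeasible (z (ψ j)).c := by
    refine ⟨hjpos, ?_⟩
    rintro (⟨k, l⟩ | ⟨k, l, m, n⟩ | ⟨m, n⟩)
    · exact sub_nonpos.2 (hjrate k l).le
    · exact sub_nonpos.2 ((le_invApprox_iff
        ((h (ψ j)).aux_pos hj le_rfl k l m n)).2 (min_le_right _ _))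
    · exact hp.2 (.inr (.inr (m, n)))
  have h1 : r ≤ (z (ψ j + 1)).R :=
    ((h (ψ j + 1)).isApproxSolution_succ hj le_rfl).2 _ hmem
  linarith [hle (ψ j + 1) (by omega)]

/-- Without vanishing maximum displacements the static form of the conditions is the plain one. -/
theorem IsKKTStatic.isKKT (hD : ∀ m n, 0 < S.D m n) {w : UAVPoint K L M N}
    (h : S.IsKKTStatic w) : S.IsKKT w := by
  have : IsEmpty S.StaticIndex := ⟨fun p => (hD p.1.1 p.1.2).ne' p.2⟩
  obtain ⟨h1, h2, -, h4, -, u, v, hu, hcs, hst⟩ := h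
  refine ⟨h1, h2, fun j => j.elim, h4, fun j => j.elim, u, fun j => j.elim, hu, hcs, ?_⟩
  rw [hst, add_right_inj, Fintype.sum_empty, Fintype.sum_empty]

theorem IsConvergedSolution.isKKTStatic (hg : 0 < S.gain) {c₀ : AuxVar K L M N}
    {z : ℕ → UAVPoint K L M N} {w : UAVPoint K L M N} (h : S.IsConvergedSolution c₀ z w) :
    S.IsKKTStatic w := by
  rcases h with ⟨q, hq, hrun, hR, rfl⟩ | ⟨hrun, hcl, hc⟩
  · obtain ⟨q, rfl⟩ : ∃ p, q = p + 1 := ⟨q - 1, by omega⟩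
    rw [Nat.add_sub_cancel] at hR
    exact (hrun.isApproxSolution_succ (by omega) le_rfl).isKKTStatic_of_R_eq hg
      (hrun.aux_pos (by omega) (by omega)) (hrun.constraint_nonpos (by omega) (by omega)) hR
  · have hw := isApproxSolution_of_mapClusterPt hg hrun hcl hc
    obtain ⟨u, v, huv⟩ := hw.exists_isMultiplier hg
    exact huv.isKKTStatic hg hc (constraint_nonpos_of_mem_approxFeasible hc hw.1)

end UAVSystem

theorem theorem4 {K L M N : ℕ} (hK : 1 ≤ K) (hL : 1 ≤ L) (hN : 1 ≤ N) (hKM : K < M)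
    (S : UAVSystem K L M N) (hP : 0 < S.P) (hτ : 0 < S.τ₀) (hσ : 0 < S.σ) (hH : 0 < S.H)
    (hD : ∀ m n, 0 ≤ S.D m n)
    (c₀ : AuxVar K L M N) (z : ℕ → UAVPoint K L M N) :
    (∀ Q, S.IsRun c₀ z Q → ∀ q, 2 ≤ q → q ≤ Q → (z (q - 1)).R ≤ (z q).R) ∧
    ((∀ Q, S.IsRun c₀ z Q) →
      (∃ r : ℝ, Filter.Tendsto (fun q => (z q).R) Filter.atTop (nhds r)) ∧
      ∀ ε : ℝ, 0 < ε → ∃ q, 2 ≤ q ∧ (z q).R - (z (q - 1)).R ≤ ε) ∧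
    (∀ w, S.IsConvergedSolution c₀ z w →
      ((∀ m n, 0 < S.D m n) → S.IsKKT w) ∧ S.IsKKTStatic w) := by
  have hg := S.gain_pos hKM hP hτ hσ
  refine ⟨fun Q h q hq hqQ => ?_, fun h => ?_, fun w hw =>
    ⟨fun hD' => (hw.isKKTStatic hg).isKKT hD', hw.isKKTStatic hg⟩⟩
  · obtain ⟨q, rfl⟩ : ∃ p, q = p + 1 := ⟨q - 1, by omega⟩
    exact h.R_le_R_succ (by omega) hqQ
  · have hbdd : BddAbove (Set.range fun q => (z (q + 1)).R) := by
      refine ⟨S.rate ⟨0, hK⟩ ⟨0, hL⟩ fun _ _ _ _ => 1 / S.H ^ 2, ?_⟩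
      rintro _ ⟨q, rfl⟩
      exact UAVSystem.R_le_rate_of_constraint_nonpos hg hH
        ((h (q + 1)).aux_pos (by omega) le_rfl) ((h (q + 1)).constraint_nonpos (by omega) le_rfl)
        _ _
    have hlim := tendsto_atTop_ciSup (UAVSystem.monotone_R_of_isRun h) hbdd
    refine ⟨⟨_, (Filter.tendsto_add_atTop_iff_nat (f := fun q => (z q).R) 1).1 hlim⟩,
      fun ε hε => ?_⟩
    have hdiff := (hlim.comp (Filter.tendsto_add_atTop_nat 1)).sub hlim
    rw [sub_self] at hdiff
    obtain ⟨q, hq⟩ := (hdiff.eventually (gt_mem_nhds hε)).exists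
    exact ⟨q + 2, by omega, hq.le⟩
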